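/- All polynomials are Laurent polynomials in $z$ over the field $\mathbb{Z}_2$. For a nonzero $f$, let $\deg f$ and $\operatorname{ord} f$ be the largest and the smallest exponent occurring in $f$. Write $f\mid g$ if $f\neq 0$ and $g=fq$ for some Laurent polynomial $q$. A $\delta$-parametric polynomial is a finite formal sum $\mathbf f=\sum_{i=s}^{t} f_i(z)\,z^{i\delta}$ with $f_i\in\mathbb{Z}_2[z^{\pm}]$; for an integer $\delta$, $\mathbf f_\delta$ denotes the Laurent polynomial obtained by substituting this value. If $\mathbf f\ne 0$, written with $f_s\neq 0\neq f_t$, put $\deg_\delta\mathbf f=t$ and $\operatorname{ord}_\delta\mathbf f=s$. A sequence $(h_\delta)_{\delta\ge 0}$ of Laurent polynomials is $(A,p)$-periodic ($A\ge 0$, $p\geq 1$) if there are integers $s\le t$, bit strings $n_s,\dots,n_t$ of length $2A+1$ and $p_s,\dots,p_{t-1}$ of length $p$ such that, for all sufficiently large $\delta$, the coefficients of $h_\delta$, listed in order of increasing degree and ending with the coefficient of $z^{\delta t+A}$, form the string $$n_s\,p_s^{(\delta-2A-1)}\,n_{s+1}\,p_{s+1}^{(\delta-2A-1)}\cdots n_{t-1}\,p_{t-1}^{(\delta-2A-1)}\,n_t,$$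 and all other coefficients vanish; here $w^{(k)}$ is the prefix of length $k$ of $w^k$. For a nonzero Laurent polynomial $f$ let $F=z^{-\operatorname{ord} f}f\in\mathbb{Z}_2[z]$, and let $V$ be the finite set of polynomials in $\mathbb{Z}_2[z]$ of degree less than $\deg F$. For $b\in\{0,1\}$ let $\tau_b:V\to V$, $\tau_b(g)=(gz+b)\bmod F$ (these are the transitions of the division-by-$F$ automaton). The period constant $P_f$ is the number of vertices of the connected component containing $\mathrm{id}_V$ in the graph whose vertices are the maps $u:V\to V$ (tuples of states) and whose edges are $u\to\tau_b\circ u$; equivalently, $P_f$ is the order of the permutation group generated by $\tau_0$ and $\tau_1$. **Theorem.** Let $\mathbf f=\sum_{i=s}^t f_i(z)z^{i\delta}$ (with $f_s\ne0\ne f_t$) and $\mathbf g$ be nonzero $\delta$-parametric polynomials such that $(\mathbf f_\delta)_{\delta\ge0}$ is $(A,1)$-periodic and $(\mathbf g_\delta)_{\delta\ge0}$ is $(B,1)$-periodic, where $A\le B$. Let $$\Delta=(\deg_\delta\mathbf g-\operatorname{ord}_\delta\mathbf g)-(\deg_\delta\mathbf f-\operatorname{ord}_\delta\mathbf f)$$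 and $P=P_{f_t}$. (a) If $\Delta<0$, then there is an integer $\delta\ge 0$ with $\mathbf f_\delta\mid\mathbf g_\delta$ if and only if there is one with $0\le\delta\le 2B+2A$. (b) If $\Delta\ge 0$, then there is an integer $\delta\ge 0$ with $\mathbf f_\delta\mid\mathbf g_\delta$ if and only if there is one with $0\le\delta\le P^{\Delta}+2(B+4A\Delta)+4A+1$. -/

import Mathlib

open scoped LaurentPolynomial

noncomputable section

namespace DivBound

/-- Laurent polynomials in `z` over the field with two elements. -/
abbrev Laurent : Type := (ZMod 2)[T;T⁻¹]

/-- The degree of a nonzero Laurent polynomial (junk value `0` for the zero polynomial). -/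
def ldeg (f : Laurent) : ℤ := f.coeff.support.max.unbotD 0

/-- The order of a nonzero Laurent polynomial (junk value `0` for the zero polynomial). -/
def lord (f : Laurent) : ℤ := f.coeff.support.min.untopD 0

/-- Divisibility of Laurent polynomials; as division by the zero polynomial is not defined,
the divisor has to be nonzero. -/
def Divides (f g : Laurent) : Prop := f ≠ 0 ∧ f ∣ g

/-! ### Parametric polynomials -/

/-- A `δ`-parametric polynomial `∑ i, f_i(z) z^{iδ}`, given by its finitely many nonzero
blocks `f_i`. -/
abbrev ParamPoly : Type := ℤ →₀ Laurent

/-- The instantiation `f_δ = ∑ i, f_i(z) z^{iδ}`. -/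
def ParamPoly.inst (f : ParamPoly) (δ : ℤ) : Laurent :=
  f.sum fun i c => c * LaurentPolynomial.T (i * δ)

/-- The `δ`-degree: the largest `i` with `f_i ≠ 0` (for a nontrivial `f`). -/
def ParamPoly.degδ (f : ParamPoly) : ℤ := f.support.max.unbotD 0

/-- The `δ`-order: the smallest `i` with `f_i ≠ 0` (for a nontrivial `f`). -/
def ParamPoly.ordδ (f : ParamPoly) : ℤ := f.support.min.untopD 0

/-- The difference of the `δ`-spans of `g` and `f`. -/
def spanDiff (f g : ParamPoly) : ℤ :=
  (g.degδ - g.ordδ) - (f.degδ - f.ordδ)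

/-- The positive divisibility problem: is there `δ ≥ 0` with `f_δ ∣ g_δ`? -/
def DivPos (f g : ParamPoly) : Prop := ∃ δ : ℤ, 0 ≤ δ ∧ Divides (f.inst δ) (g.inst δ)

/-! ### Piecewise periodic sequences -/

/-- `(D, w)` is a (not necessarily strict) representation of `f`:
`w = a_d … a_D` lists the coefficients of `f` in the degrees `d, …, D`, and there are no
others. -/
def Represents (f : Laurent) (D : ℤ) (w : List (ZMod 2)) : Prop :=
  f = ∑ k : Fin w.length,
    LaurentPolynomial.C (w.get k) * LaurentPolynomial.T (D - w.length + 1 + (k : ℤ))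

/-- The prefix of length `k` of `w ^ k` (for a nonempty `w`). -/
def periodicWord (w : List (ZMod 2)) (k : ℕ) : List (ZMod 2) :=
  (List.replicate k w).flatten.take k

/-- The word `n_s ∘ p_s^(m) ∘ ⋯ ∘ n_{t-1} ∘ p_{t-1}^(m) ∘ n_t`. -/
def pieceWord (s t : ℤ) (n p : ℤ → List (ZMod 2)) (m : ℕ) : List (ZMod 2) :=
  ((List.range (t - s).toNat).flatMap fun i =>
    n (s + (i : ℤ)) ++ periodicWord (p (s + (i : ℤ))) m) ++ n t

/-- A sequence of Laurent polynomials is `(A, p)`-periodic. -/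
def IsPeriodicSeq (A p : ℕ) (h : ℕ → Laurent) : Prop :=
  0 < p ∧ ∃ s t : ℤ, s ≤ t ∧ ∃ n q : ℤ → List (ZMod 2),
    (∀ i, s ≤ i → i ≤ t → (n i).length = 2 * A + 1) ∧
    (∀ i, s ≤ i → i < t → (q i).length = p) ∧
    ∃ N : ℕ, 2 * A + 1 ≤ N ∧ ∀ δ : ℕ, N ≤ δ →
      Represents (h δ) ((δ : ℤ) * t + A) (pieceWord s t n q (δ - 2 * A - 1))

/-! ### The division automaton and the period constant -/

/-- States of the division-by-`f` automaton: the polynomials of degree less than `deg f`. -/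
def State (f : Polynomial (ZMod 2)) : Type :=
  {g : Polynomial (ZMod 2) // g.degree < f.degree}

/-- The transition `g ↦ (g z + b) % f` of the division-by-`f` automaton. -/
def trans (f : Polynomial (ZMod 2)) (b : ZMod 2) (g : State f) : State f :=
  ⟨(g.1 * Polynomial.X + Polynomial.C b) % f, Polynomial.degree_mod_lt _ (by
    intro h
    exact absurd g.2 (by simp [h]))⟩

/-- The edges of the product of copies of the automaton, one copy for each choice of root.
A vertex is a tuple of states indexed by the states, and the bit `b` is read in all
coordinates simultaneously. -/
def ProductEdge (f : Polynomial (ZMod 2)) (u v : State f → State f) : Prop :=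
  ∃ b : ZMod 2, ∀ x, v x = trans f b (u x)

/-- The number of vertices of the connected component of the product graph that contains the
root tuple `(v)_{v ∈ V}`. For `f` with nonzero constant term this component is the Cayley graph
of the (finite) group generated by the two transition permutations of the automaton, so this
number is the order of that group. -/
def polyPeriod (f : Polynomial (ZMod 2)) : ℕ :=
  Set.ncard {u : State f → State f | Relation.EqvGen (ProductEdge f) id u}

/-- The polynomial `f · z^{-ord f}` in `ℤ₂[z]`, which has nonzero constant term if `f ≠ 0`. -/
def shiftToPoly (f : Laurent) : Polynomial (ZMod 2) :=
  LaurentPolynomial.trunc (f * LaurentPolynomial.T (-lord f))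

/-- The period constant `P_f` of a nonzero Laurent polynomial. -/
def periodConst (f : Laurent) : ℕ := polyPeriod (shiftToPoly f)

end DivBound

end

/-!
Multiplication of `f_δ` by `z - 1` turns the constant parts of an `(A, 1)`-periodic word into
single letters next to the multiples of `δ`. Comparing blocks for large `δ` shows that all blocks
`f_i` are supported in `[-A, A]` (`IsPeriodicSeq.supportedIn`), and likewise those of `g` in
`[-B, B]`. For `δ > 2 * A` the blocks of `f_δ` do not overlap, hence `f_δ ≠ 0` and its span is
known up to `2 * A`. If the `δ`-span of `g` is smaller than that of `f`, then comparing the spans of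
`f_δ` and `g_δ` bounds `δ` (`ParamPoly.le_of_inst_dvd_inst`), which settles the case `Δ < 0`.

Let `Δ ≥ 0` and let `c` be the leading block of `f`. Pseudo-division in the variable `z^δ` gives
`c ^ (Δ + 1) * g_δ = Q_δ * f_δ + r_δ` for all `δ` at once, where `Q` has `Δ + 1` blocks, the
`δ`-span of `r` is smaller than that of `f`, and the blocks of `r` are supported in
`[-(B + (Δ + 1) * A), B + (Δ + 1) * A]` (`exists_pseudoDivision`). If `f_δ ∣ g_δ` for one large `δ`,
then `f_δ ∣ r_δ`, so `r = 0` by the comparison of spans. Now `f_δ ∣ g_δ` is equivalent to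
`c ^ (Δ + 1) ∣ Q_δ` for every `δ` with `f_δ ≠ 0`, and this condition depends only on `δ` modulo any
`M` with `c ^ (Δ + 1) ∣ z ^ M - 1`; for `Δ = 0` it does not depend on `δ` at all
(`inst_dvd_inst_of_periodic`).

It remains to see that `M = P ^ Δ` is such a number if `Δ > 0`. The period constant `P` is the order
of the group generated by the affine maps `x ↦ z x` and `x ↦ z x + 1` of `ℤ₂[z]/(F)`, where `F` is
`c` shifted to a polynomial with nonzero constant term. If `F` is not a unit, the linear parts of
the group contain a cyclic group of order `e`, the order of `z` modulo `F`, and the translations in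
it contain `x ↦ x + 1`, so `2 * e ∣ P` (`two_mul_orderOf_dvd_card`). Thus `z ^ (P ^ Δ) - 1` is
divisible by `z ^ (e * 2 ^ Δ) - 1 = (z ^ e - 1) ^ (2 ^ Δ)`, hence by `F ^ (2 ^ Δ)`, and
`Δ + 1 ≤ 2 ^ Δ`.
-/

noncomputable section

namespace DivBound

section

open LaurentPolynomial

/-! ### Supports of Laurent polynomials -/

/-- All exponents occurring in `f` lie in the interval `[a, b]`. The zero polynomial qualifies for
every `a` and `b`. -/
def SupportedIn (a b : ℤ) (f : Laurent) : Prop := ∀ k, f.coeff k ≠ 0 → a ≤ k ∧ k ≤ b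

theorem coeff_mul_T (f : Laurent) (n k : ℤ) : (f * T n).coeff k = f.coeff (k - n) := by
  rw [T, AddMonoidAlgebra.coeff_mul_single_apply, mul_one, sub_eq_add_neg]

theorem exists_coeff_ne_zero {f : Laurent} (hf : f ≠ 0) : ∃ k, f.coeff k ≠ 0 := by
  by_contra! h
  exact hf (LaurentPolynomial.ext fun a => by simpa using h a)

theorem exists_greatest_exponent {f : Laurent} (hf : f ≠ 0) :
    ∃ m, f.coeff m ≠ 0 ∧ ∀ k, f.coeff k ≠ 0 → k ≤ m := by
  obtain ⟨k, hk⟩ := exists_coeff_ne_zero hf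
  obtain ⟨m, hm, hmax⟩ := f.coeff.support.exists_max_image id ⟨k, by simpa using hk⟩
  exact ⟨m, by simpa using hm, fun j hj => hmax j (by simpa using hj)⟩

theorem exists_least_exponent {f : Laurent} (hf : f ≠ 0) :
    ∃ m, f.coeff m ≠ 0 ∧ ∀ k, f.coeff k ≠ 0 → m ≤ k := by
  obtain ⟨k, hk⟩ := exists_coeff_ne_zero hf
  obtain ⟨m, hm, hmin⟩ := f.coeff.support.exists_min_image id ⟨k, by simpa using hk⟩
  exact ⟨m, by simpa using hm, fun j hj => hmin j (by simpa using hj)⟩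

theorem supportedIn_zero (a b : ℤ) : SupportedIn a b 0 := fun k hk => by simp at hk

theorem SupportedIn.mono {a b c d : ℤ} {f : Laurent} (h : SupportedIn a b f) (hc : c ≤ a)
    (hd : b ≤ d) : SupportedIn c d f := fun k hk => by
  have := h k hk
  omega

theorem SupportedIn.add {a b : ℤ} {f g : Laurent} (hf : SupportedIn a b f)
    (hg : SupportedIn a b g) : SupportedIn a b (f + g) := fun k hk => by
  by_cases h : f.coeff k = 0
  · exact hg k (by simpa [h] using hk)
  · exact hf k h

theorem SupportedIn.neg {a b : ℤ} {f : Laurent} (hf : SupportedIn a b f) :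
    SupportedIn a b (-f) := fun k hk => hf k (by simpa using hk)

theorem SupportedIn.sum {ι : Type*} {a b : ℤ} {s : Finset ι} {f : ι → Laurent}
    (h : ∀ i ∈ s, SupportedIn a b (f i)) : SupportedIn a b (∑ i ∈ s, f i) :=
  Finset.sum_induction f (SupportedIn a b) (fun _ _ => SupportedIn.add) (supportedIn_zero a b) h

theorem SupportedIn.mul_T {a b : ℤ} {f : Laurent} (hf : SupportedIn a b f) (n : ℤ) :
    SupportedIn (a + n) (b + n) (f * T n) := fun k hk => by
  rw [coeff_mul_T] at hk
  have := hf _ hk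
  omega

theorem supportedIn_T (n : ℤ) : SupportedIn n n (T n) := fun k hk => by
  simp at hk
  omega

theorem supportedIn_C (c : ZMod 2) : SupportedIn 0 0 (C c) := fun k hk => by
  simp at hk
  omega

theorem SupportedIn.mul {a b c d : ℤ} {f g : Laurent} (hf : SupportedIn a b f)
    (hg : SupportedIn c d g) : SupportedIn (a + c) (b + d) (f * g) := fun k hk => by
  classical
  have := AddMonoidAlgebra.support_coeff_mul_subset f g (Finsupp.mem_support_iff.2 hk)
  obtain ⟨i, hi, j, hj, rfl⟩ := Finset.mem_add.1 this
  have := hf i (by simpa using hi)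
  have := hg j (by simpa using hj)
  omega

/-- Extreme exponents do not cancel in a product, so that sums of exponents of the two factors
are confined to every interval that contains the exponents of the product. -/
theorem SupportedIn.add_mem_of_mul {a b u k : ℤ} {p q : Laurent} (h : SupportedIn a b (p * q))
    (hu : p.coeff u ≠ 0) (hk : q.coeff k ≠ 0) : a ≤ u + k ∧ u + k ≤ b := by
  have hp : p ≠ 0 := by rintro rfl; simp at hu
  have hq : q ≠ 0 := by rintro rfl; simp at hk
  obtain ⟨m, hm, hm'⟩ := exists_least_exponent hp
  obtain ⟨n, hn, hn'⟩ := exists_least_exponent hq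
  obtain ⟨M, hM, hM'⟩ := exists_greatest_exponent hp
  obtain ⟨N, hN, hN'⟩ := exists_greatest_exponent hq
  have hlow : (p * q).coeff (m + n) = p.coeff m * q.coeff n := by
    refine AddMonoidAlgebra.coeff_mul_add_of_uniqueAdd fun i j hi hj hij => ?_
    have := hm' i (by simpa using hi)
    have := hn' j (by simpa using hj)
    omega
  have hhigh : (p * q).coeff (M + N) = p.coeff M * q.coeff N := by
    refine AddMonoidAlgebra.coeff_mul_add_of_uniqueAdd fun i j hi hj hij => ?_
    have := hM' i (by simpa using hi)
    have := hN' j (by simpa using hj)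
    omega
  have h1 := h (m + n) (by rw [hlow]; exact mul_ne_zero hm hn)
  have h2 := h (M + N) (by rw [hhigh]; exact mul_ne_zero hM hN)
  have := hm' u hu
  have := hn' k hk
  have := hM' u hu
  have := hN' k hk
  omega

/-- A divisor of a nonzero Laurent polynomial has no larger span. -/
theorem SupportedIn.span_le_of_dvd {a b u v : ℤ} {p g : Laurent} (h : SupportedIn a b g)
    (hg : g ≠ 0) (hpg : p ∣ g) (hu : p.coeff u ≠ 0) (hv : p.coeff v ≠ 0) : v - u ≤ b - a := by
  obtain ⟨q, rfl⟩ := hpg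
  obtain ⟨k, hk⟩ := exists_coeff_ne_zero (right_ne_zero_of_mul hg)
  have := h.add_mem_of_mul hu hk
  have := h.add_mem_of_mul hv hk
  omega

/-! ### Instances of parametric polynomials -/

theorem ParamPoly.inst_zero (δ : ℤ) : ParamPoly.inst 0 δ = 0 := Finsupp.sum_zero_index

theorem ParamPoly.inst_add (f g : ParamPoly) (δ : ℤ) :
    ParamPoly.inst (f + g) δ = f.inst δ + g.inst δ :=
  Finsupp.sum_add_index' (by simp) (by intros; ring)

theorem ParamPoly.inst_neg (f : ParamPoly) (δ : ℤ) : ParamPoly.inst (-f) δ = -f.inst δ := by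
  rw [eq_neg_iff_add_eq_zero, ← ParamPoly.inst_add, neg_add_cancel, ParamPoly.inst_zero]

theorem ParamPoly.inst_sub (f g : ParamPoly) (δ : ℤ) :
    ParamPoly.inst (f - g) δ = f.inst δ - g.inst δ := by
  rw [sub_eq_add_neg, ParamPoly.inst_add, ParamPoly.inst_neg, sub_eq_add_neg]

theorem ParamPoly.inst_single (i : ℤ) (c : Laurent) (δ : ℤ) :
    ParamPoly.inst (Finsupp.single i c) δ = c * T (i * δ) :=
  Finsupp.sum_single_index (by simp)

theorem ParamPoly.inst_smul (c : Laurent) (f : ParamPoly) (δ : ℤ) :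
    ParamPoly.inst (c • f) δ = c * f.inst δ := by
  rw [ParamPoly.inst, Finsupp.sum_smul_index' (by simp), ParamPoly.inst, Finsupp.mul_sum]
  simp [mul_assoc]

/-- The parametric polynomial `z^{kδ} f`. -/
def ParamPoly.shift (k : ℤ) (f : ParamPoly) : ParamPoly :=
  Finsupp.equivMapDomain (Equiv.addRight k) f

theorem ParamPoly.shift_apply (k : ℤ) (f : ParamPoly) (i : ℤ) :
    ParamPoly.shift k f i = f (i - k) := by
  simp [ParamPoly.shift, sub_eq_add_neg]

theorem ParamPoly.inst_shift (k : ℤ) (f : ParamPoly) (δ : ℤ) :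
    (ParamPoly.shift k f).inst δ = f.inst δ * T (k * δ) := by
  rw [ParamPoly.shift, Finsupp.equivMapDomain_eq_mapDomain, ParamPoly.inst,
    Finsupp.sum_mapDomain_index (by simp) (by intros; ring), ParamPoly.inst, Finsupp.sum_mul]
  refine Finsupp.sum_congr fun i _ => ?_
  rw [mul_assoc, ← T_add, Equiv.coe_addRight, add_mul]

/-- If the blocks are narrow compared to `δ`, they do not overlap in `f_δ`. -/
theorem ParamPoly.coeff_inst {f : ParamPoly} {W δ k : ℤ} (hf : ∀ i, SupportedIn (-W) W (f i))
    (hδ : 2 * W < δ) (hk : -W ≤ k) (hk' : k ≤ W) (i : ℤ) :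
    (f.inst δ).coeff (i * δ + k) = (f i).coeff k := by
  rw [ParamPoly.inst, AddMonoidAlgebra.coeff_finsuppSum, Finsupp.sum, Finsupp.finsetSum_apply]
  simp only [coeff_mul_T]
  rw [Finset.sum_eq_single i]
  · congr 1
    ring
  · intro j _ hji
    by_contra h
    have h1 := hf j _ h
    have h2 : i * δ + k - j * δ = (i - j) * δ + k := by ring
    rw [h2] at h1
    rcases lt_or_gt_of_ne hji with hlt | hgt
    · nlinarith
    · nlinarith
  · intro hi
    simp [Finsupp.notMem_support_iff.1 hi]

theorem ParamPoly.inst_ne_zero {f : ParamPoly} (hf0 : f ≠ 0) {W δ : ℤ}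
    (hf : ∀ i, SupportedIn (-W) W (f i)) (hδ : 2 * W < δ) : f.inst δ ≠ 0 := by
  obtain ⟨i, hi⟩ := Finsupp.ne_iff.1 hf0
  obtain ⟨k, hk⟩ := exists_coeff_ne_zero hi
  have hkW := hf i k hk
  intro h
  have := ParamPoly.coeff_inst hf hδ hkW.1 hkW.2 i
  rw [h] at this
  exact hk (by simpa using this.symm)

theorem ParamPoly.supportedIn_inst {f : ParamPoly} {W δ a b : ℤ}
    (hf : ∀ i, SupportedIn (-W) W (f i)) (hδ : 0 ≤ δ) (hab : ∀ i, f i ≠ 0 → a ≤ i ∧ i ≤ b) :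
    SupportedIn (a * δ - W) (b * δ + W) (f.inst δ) := by
  refine SupportedIn.sum fun i hi => ?_
  have := hab i (by simpa using hi)
  exact ((hf i).mul_T (i * δ)).mono (by nlinarith) (by nlinarith)

theorem exists_forall_supportedIn (f : ParamPoly) :
    ∃ W : ℕ, ∀ i, SupportedIn (-W) W (f i) := by
  refine ⟨f.support.sup fun i => (f i).coeff.support.sup Int.natAbs, fun i k hk => ?_⟩
  have hi : i ∈ f.support := by
    rw [Finsupp.mem_support_iff]
    intro h
    simp [h] at hk
  have h1 : k.natAbs ≤ (f i).coeff.support.sup Int.natAbs :=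
    Finset.le_sup (f := Int.natAbs) (by simpa using hk)
  have h2 := Finset.le_sup (f := fun i => (f i).coeff.support.sup Int.natAbs) hi
  omega

/-- A parametric polynomial is determined by its instances at large `δ`. -/
theorem ParamPoly.eq_of_eventually_inst_eq {f g : ParamPoly} {N : ℕ}
    (h : ∀ δ : ℕ, N ≤ δ → f.inst δ = g.inst δ) : f = g := by
  by_contra hne
  obtain ⟨W, hW⟩ := exists_forall_supportedIn (f - g)
  refine ParamPoly.inst_ne_zero (sub_ne_zero.2 hne) hW (δ := ((N + 2 * W + 1 : ℕ) : ℤ))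
    (by push_cast; omega) ?_
  rw [ParamPoly.inst_sub, h _ (by omega), sub_self]

theorem ParamPoly.le_degδ {f : ParamPoly} {i : ℤ} (hi : f i ≠ 0) : i ≤ f.degδ := by
  obtain ⟨m, hm⟩ := Finset.max_of_mem (Finsupp.mem_support_iff.2 hi)
  rw [ParamPoly.degδ, hm]
  exact Finset.le_max_of_eq (Finsupp.mem_support_iff.2 hi) hm

theorem ParamPoly.ordδ_le {f : ParamPoly} {i : ℤ} (hi : f i ≠ 0) : f.ordδ ≤ i := by
  obtain ⟨m, hm⟩ := Finset.min_of_mem (Finsupp.mem_support_iff.2 hi)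
  rw [ParamPoly.ordδ, hm]
  exact Finset.min_le_of_eq (Finsupp.mem_support_iff.2 hi) hm

theorem ParamPoly.apply_degδ_ne_zero {f : ParamPoly} (hf : f ≠ 0) : f f.degδ ≠ 0 := by
  obtain ⟨m, hm⟩ := Finset.max_of_nonempty (Finsupp.support_nonempty_iff.2 hf)
  rw [ParamPoly.degδ, hm]
  exact Finsupp.mem_support_iff.1 (Finset.mem_of_max hm)

theorem ParamPoly.apply_ordδ_ne_zero {f : ParamPoly} (hf : f ≠ 0) : f f.ordδ ≠ 0 := by
  obtain ⟨m, hm⟩ := Finset.min_of_nonempty (Finsupp.support_nonempty_iff.2 hf)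
  rw [ParamPoly.ordδ, hm]
  exact Finsupp.mem_support_iff.1 (Finset.mem_of_min hm)

/-- If the `δ`-span of `g` is smaller than that of `f`, then `f_δ ∣ g_δ` only for small `δ`: for
larger ones the gap of at least `δ` between the spans exceeds the total width of the end blocks. -/
theorem ParamPoly.le_of_inst_dvd_inst {f g : ParamPoly} (hf : f ≠ 0) (hg : g ≠ 0)
    {A B δ a b : ℤ} (hA : ∀ i, SupportedIn (-A) A (f i)) (hB : ∀ i, SupportedIn (-B) B (g i))
    (hB0 : 0 ≤ B) (hδ : 0 ≤ δ) (hab : ∀ i, g i ≠ 0 → a ≤ i ∧ i ≤ b)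
    (hspan : b - a < f.degδ - f.ordδ) (hdvd : f.inst δ ∣ g.inst δ) : δ ≤ 2 * B + 2 * A := by
  by_contra! hlt
  obtain ⟨k, hk⟩ := exists_coeff_ne_zero (ParamPoly.apply_degδ_ne_zero hf)
  obtain ⟨l, hl⟩ := exists_coeff_ne_zero (ParamPoly.apply_ordδ_ne_zero hf)
  have hkA := hA _ k hk
  have hlA := hA _ l hl
  rw [← ParamPoly.coeff_inst hA (by omega : 2 * A < δ) hkA.1 hkA.2] at hk
  rw [← ParamPoly.coeff_inst hA (by omega : 2 * A < δ) hlA.1 hlA.2] at hl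
  have := (ParamPoly.supportedIn_inst hB hδ hab).span_le_of_dvd
    (ParamPoly.inst_ne_zero hg hB (by omega)) hdvd hl hk
  nlinarith

end

section

open LaurentPolynomial

/-! ### Pseudo-division in the variable `z^δ` -/

/-- Pseudo-division of `g` by `f` with respect to the variable `z^δ`, carried out simultaneously
for all `δ`. Each of the `n` steps multiplies by the leading block `c` of `f` and cancels the
leading block of the dividend. The quotient has the `n` blocks `Q j`; the `δ`-span of the remainder
is smaller than that of `f`, and its blocks have become wider by at most `A` in each step. -/
theorem exists_pseudoDivision {f : ParamPoly} {A : ℤ}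
    (hA : ∀ i, SupportedIn (-A) A (f i)) (a : ℤ) (n : ℕ) {g : ParamPoly} {B : ℤ}
    (hB : ∀ i, SupportedIn (-B) B (g i))
    (hg : ∀ i, g i ≠ 0 → a ≤ i ∧ i < a + (f.degδ - f.ordδ) + n) :
    ∃ (Q : ℕ → Laurent) (r : ParamPoly),
      (∀ i, SupportedIn (-(B + n * A)) (B + n * A) (r i)) ∧
      (∀ i, r i ≠ 0 → a ≤ i ∧ i < a + (f.degδ - f.ordδ)) ∧
      ∀ δ : ℤ, f f.degδ ^ n * g.inst δ =
        (∑ j ∈ Finset.range n, Q j * T (j * δ)) * T ((a - f.ordδ) * δ) * f.inst δ + r.inst δ := by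
  induction n generalizing g B with
  | zero => exact ⟨0, g, by simpa using hB, by simpa using hg, by simp⟩
  | succ n ih =>
    set m : ℤ := a + (f.degδ - f.ordδ) + n
    set k : ℤ := n + (a - f.ordδ)
    have hmk : m - k = f.degδ := by simp only [m, k]; ring
    obtain ⟨Q, r, hr, hr', hQ⟩ := ih (B := B + A)
      (g := f f.degδ • g - g m • ParamPoly.shift k f) (fun i => by
        rw [sub_eq_add_neg]
        refine SupportedIn.add ?_ (SupportedIn.neg ?_)
        · rw [Finsupp.smul_apply, smul_eq_mul]
          exact ((hA _).mul (hB i)).mono (by omega) (by omega)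
        · rw [Finsupp.smul_apply, smul_eq_mul, ParamPoly.shift_apply]
          exact ((hB _).mul (hA _)).mono (by omega) (by omega)) (fun i hi => by
        rw [Finsupp.sub_apply, Finsupp.smul_apply, Finsupp.smul_apply, ParamPoly.shift_apply,
          smul_eq_mul, smul_eq_mul] at hi
        -- The coefficients at `m` cancel.
        have him : i ≠ m := by
          rintro rfl
          rw [hmk, mul_comm, sub_self] at hi
          exact hi rfl
        by_cases h1 : g i = 0
        · have h2 : f (i - k) ≠ 0 := by
            intro h2
            simp [h1, h2] at hi
          have := ParamPoly.le_degδ h2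
          have := ParamPoly.ordδ_le h2
          omega
        · have := hg i h1
          push_cast at this
          omega)
    refine ⟨Function.update Q n (f f.degδ ^ n * g m), r, fun i => ?_, hr', fun δ => ?_⟩
    · have := hr i
      push_cast
      rwa [show B + (n + 1) * A = B + A + n * A by ring]
    · have h := hQ δ
      rw [ParamPoly.inst_sub, ParamPoly.inst_smul, ParamPoly.inst_smul, ParamPoly.inst_shift] at h
      rw [Finset.sum_range_succ, Function.update_self,
        Finset.sum_congr rfl (g := fun j => Q j * T (j * δ))
          (fun j hj => by rw [Function.update_of_ne (Finset.mem_range.1 hj).ne]), pow_succ]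
      have hT : (T (k * δ) : Laurent) = T (n * δ) * T ((a - f.ordδ) * δ) := by
        rw [← T_add, ← add_mul]
      rw [hT] at h
      linear_combination h

/-! ### Dependence of the quotient on `δ` modulo the period -/

theorem T_sub_one_dvd (M : ℤ) (j m : ℕ) : (T M - 1 : Laurent) ∣ T (j * (m * M)) - 1 := by
  have : (T (j * (m * M)) : Laurent) = T M ^ (j * m) := by
    rw [T_pow]
    push_cast
    ring_nf
  rw [this]
  exact sub_one_dvd_pow_sub_one _ _

/-- Modulo a divisor of `z^M - 1`, the Laurent polynomial `∑ j, Q j * z^(jδ)` depends only on the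
residue of `δ` modulo `M`. -/
theorem dvd_sum_T_of_dvd {h : Laurent} {M : ℤ} (hM : h ∣ T M - 1) (Q : ℕ → Laurent)
    (n : ℕ) (δ : ℤ) (m : ℕ)
    (hd : h ∣ ∑ j ∈ Finset.range n, Q j * T (j * (δ + m * M))) :
    h ∣ ∑ j ∈ Finset.range n, Q j * T (j * δ) := by
  rw [← dvd_sub_right hd, ← Finset.sum_sub_distrib]
  refine Finset.dvd_sum fun j _ => ?_
  have : Q j * T (j * (δ + m * M)) - Q j * T (j * δ)
      = Q j * T (j * δ) * (T (j * (m * M)) - 1) := by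
    rw [mul_add, T_add]
    ring
  rw [this]
  exact Dvd.dvd.mul_left (hM.trans (T_sub_one_dvd M j m)) _

/-- A large solution `δ + mM` of the divisibility problem can be lowered to `δ`. For large
parameters the remainder of the pseudo-division vanishes for degree reasons, so that the quotient
decides about divisibility. With a single block (`n = 0`) the quotient does not depend on the
parameter, except for a unit. -/
theorem inst_dvd_inst_of_periodic {f g : ParamPoly} (hf : f ≠ 0) {A B : ℤ} (hA0 : 0 ≤ A)
    (hB0 : 0 ≤ B) (hA : ∀ i, SupportedIn (-A) A (f i)) (hB : ∀ i, SupportedIn (-B) B (g i))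
    (n : ℕ) (hn : spanDiff f g = n) {M : ℤ} (hM : n ≠ 0 → f f.degδ ^ (n + 1) ∣ T M - 1)
    {δ : ℤ} {m : ℕ} (hlarge : 2 * (B + (n + 1) * A) + 2 * A < δ + m * M)
    (hdvd : f.inst (δ + m * M) ∣ g.inst (δ + m * M)) : f.inst δ ∣ g.inst δ := by
  obtain ⟨Q, r, hr, hr', hQ⟩ := exists_pseudoDivision hA g.ordδ (n + 1) hB (fun i hi => by
    have := ParamPoly.le_degδ hi
    have := ParamPoly.ordδ_le hi
    rw [spanDiff] at hn
    push_cast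
    omega)
  have hc : f f.degδ ^ (n + 1) ≠ 0 := pow_ne_zero _ (ParamPoly.apply_degδ_ne_zero hf)
  have hnA : 0 ≤ (n + 1 : ℤ) * A := by positivity
  have hr0 : r = 0 := by
    by_contra hr0
    have hrd : f.inst (δ + m * M) ∣ r.inst (δ + m * M) := by
      rw [← dvd_add_right (Dvd.intro_left _ rfl), ← hQ]
      exact hdvd.mul_left _
    have := ParamPoly.le_of_inst_dvd_inst hf hr0 hA hr (by push_cast; omega)
      (by omega) (a := g.ordδ) (b := g.ordδ + (f.degδ - f.ordδ) - 1)
      (fun i hi => by have := hr' i hi; omega) (by omega) hrd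
    push_cast at this
    omega
  subst hr0
  simp only [ParamPoly.inst_zero, add_zero] at hQ
  have hquot : f f.degδ ^ (n + 1) ∣
      ∑ j ∈ Finset.range (n + 1), Q j * T (j * (δ + m * M)) := by
    obtain ⟨q, hq⟩ := hdvd
    have hne := ParamPoly.inst_ne_zero hf hA (by omega : 2 * A < δ + m * M)
    have h := hQ (δ + m * M)
    rw [hq, mul_left_comm, mul_comm (f.inst _)] at h
    rw [← (isUnit_T ((g.ordδ - f.ordδ) * (δ + m * M))).dvd_mul_right, ← mul_right_cancel₀ hne h]
    exact dvd_mul_right _ _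
  have hquot' : f f.degδ ^ (n + 1) ∣ ∑ j ∈ Finset.range (n + 1), Q j * T (j * δ) := by
    rcases eq_or_ne n 0 with rfl | h0
    · simpa using hquot
    · exact dvd_sum_T_of_dvd (hM h0) Q _ δ m hquot
  have h := hQ δ
  obtain ⟨q, hq⟩ := hquot'
  rw [hq, mul_assoc, mul_assoc] at h
  rw [mul_left_cancel₀ hc h, ← mul_assoc]
  exact dvd_mul_left _ _

end

section

/-! ### The period constant -/

/-- The affine map `x ↦ u x + b`. If `K` is the quotient ring `ℤ₂[z]/(F)` and `u` is the class of
`z`, this is the transition of the division automaton of `F` on reading `b`. -/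
def transAffine {K : Type*} [CommRing K] [Algebra (ZMod 2) K] (u : Kˣ) (b : ZMod 2) :
    K ≃ᵃ[ZMod 2] K :=
  AffineEquiv.constVAdd (ZMod 2) K (algebraMap (ZMod 2) K b) *
    (Units.mulLeftLinearEquiv (ZMod 2) K u).toAffineEquiv

theorem transAffine_apply {K : Type*} [CommRing K] [Algebra (ZMod 2) K] (u : Kˣ) (b : ZMod 2)
    (x : K) : transAffine u b x = u * x + algebraMap (ZMod 2) K b := by
  simp [transAffine, add_comm]

/-- The group generated by the two maps `x ↦ u x` and `x ↦ u x + 1`. -/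
def transGroup {K : Type*} [CommRing K] [Algebra (ZMod 2) K] (u : Kˣ) :
    Subgroup (K ≃ᵃ[ZMod 2] K) :=
  Subgroup.closure (Set.range (transAffine u))

theorem transAffine_mem {K : Type*} [CommRing K] [Algebra (ZMod 2) K] (u : Kˣ) (b : ZMod 2) :
    transAffine u b ∈ transGroup u :=
  Subgroup.subset_closure ⟨b, rfl⟩

/-- The linear parts of the transitions generate a cyclic group of order `orderOf u`, and the
translation by `1` is a nontrivial involution with trivial linear part. -/
theorem two_mul_orderOf_dvd_card {K : Type*} [CommRing K] [Nontrivial K] [Algebra (ZMod 2) K]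
    [Finite K] (u : Kˣ) : 2 * orderOf u ∣ Nat.card (transGroup u) := by
  have : Finite (K ≃ᵃ[ZMod 2] K) := Finite.of_injective _ DFunLike.coe_injective
  let φ : transGroup u →* (K ≃ₗ[ZMod 2] K) := AffineEquiv.linearHom.comp (transGroup u).subtype
  rw [← φ.ker.card_mul_index, Subgroup.index_ker]
  refine mul_dvd_mul ?_ ?_
  · let τ : transGroup u :=
      ⟨transAffine u 1 * (transAffine u 0)⁻¹,
        mul_mem (transAffine_mem u 1) (inv_mem (transAffine_mem u 0))⟩
    have hτ : ∀ x : K, (τ : K ≃ᵃ[ZMod 2] K) x = x + 1 := fun x => by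
      obtain ⟨y, rfl⟩ := (transAffine u 0).surjective x
      change transAffine u 1 ((transAffine u 0).symm (transAffine u 0 y)) = _
      rw [AffineEquiv.symm_apply_apply, transAffine_apply, transAffine_apply]
      simp
    have hker : τ ∈ φ.ker := by
      rw [MonoidHom.mem_ker]
      ext x
      have h : (τ : K ≃ᵃ[ZMod 2] K).linear x = x := by
        have := (τ : K ≃ᵃ[ZMod 2] K).map_vadd 0 x
        rw [hτ, hτ] at this
        simpa using this.symm
      exact h
    have hord : orderOf (⟨τ, hker⟩ : φ.ker) = 2 := by
      refine orderOf_eq_prime ?_ ?_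
      · ext x
        have h2 : (1 + 1 : K) = 0 := by
          have : algebraMap (ZMod 2) K (1 + 1) = 0 := by
            rw [show (1 + 1 : ZMod 2) = 0 from rfl, map_zero]
          simpa using this
        have h : (τ : K ≃ᵃ[ZMod 2] K) ((τ : K ≃ᵃ[ZMod 2] K) x) = x := by
          rw [hτ, hτ, add_assoc, h2, add_zero]
        rw [pow_two]
        exact h
      · intro h
        have h0 : (τ : K ≃ᵃ[ZMod 2] K) 0 = 0 := by
          have h' : τ = 1 := congrArg Subtype.val h
          rw [h']
          rfl
        rw [hτ] at h0
        simp at h0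
    exact hord.symm.dvd.trans (orderOf_dvd_natCard _)
  · have hmem : Units.mulLeftLinearEquiv (ZMod 2) K u ∈ φ.range :=
      ⟨⟨_, transAffine_mem u 0⟩, LinearEquiv.ext fun _ => rfl⟩
    have hinj : Function.Injective (Units.mulLeftLinearEquiv (ZMod 2) K) := fun v w h => by
      have := congrArg (fun e : K ≃ₗ[ZMod 2] K => e 1) h
      exact Units.ext (by simpa using this)
    rw [← orderOf_injective _ hinj u, ← Subgroup.orderOf_mk _ hmem]
    exact orderOf_dvd_natCard _

open Polynomial

/-- The bijection between the states of the division automaton and the quotient ring. -/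
def stateEquiv {F : (ZMod 2)[X]} (hF : F ≠ 0) : State F ≃ AdjoinRoot F :=
  Equiv.ofBijective (fun x => AdjoinRoot.mk F x.1) ⟨fun x y h => by
    have hd : F ∣ x.1 - y.1 := AdjoinRoot.mk_eq_mk.1 h
    exact Subtype.ext (sub_eq_zero.1 (eq_zero_of_dvd_of_degree_lt hd
      ((degree_sub_le _ _).trans_lt (max_lt x.2 y.2)))), fun x => by
    obtain ⟨p, rfl⟩ := AdjoinRoot.mk_surjective x
    refine ⟨⟨p % F, degree_mod_lt _ hF⟩, AdjoinRoot.mk_eq_mk.2 ?_⟩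
    rw [← dvd_neg, neg_sub]
    exact ⟨p / F, by rw [sub_eq_iff_eq_add, EuclideanDomain.div_add_mod]⟩⟩

theorem stateEquiv_trans {F : (ZMod 2)[X]} (hF : F ≠ 0) (b : ZMod 2) (x : State F) :
    stateEquiv hF (trans F b x) = AdjoinRoot.root F * stateEquiv hF x + algebraMap _ _ b := by
  have h : AdjoinRoot.mk F ((x.1 * X + C b) % F) = AdjoinRoot.mk F (x.1 * X + C b) := by
    refine AdjoinRoot.mk_eq_mk.2 ?_
    rw [← dvd_neg, neg_sub]
    exact ⟨_, by rw [sub_eq_iff_eq_add, EuclideanDomain.div_add_mod]⟩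
  change AdjoinRoot.mk F ((x.1 * X + C b) % F) = AdjoinRoot.root F * AdjoinRoot.mk F x.1 + _
  rw [h, map_add, map_mul, AdjoinRoot.mk_X, mul_comm]
  rfl

/-- The component of the identity in the product graph is the Cayley graph of the group generated
by the transitions. -/
theorem polyPeriod_eq_card {F : (ZMod 2)[X]} (hF : F ≠ 0) {u : (AdjoinRoot F)ˣ}
    (hu : (u : AdjoinRoot F) = AdjoinRoot.root F) :
    polyPeriod F = Nat.card (transGroup u) := by
  let Φ : (AdjoinRoot F ≃ᵃ[ZMod 2] AdjoinRoot F) → State F → State F :=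
    fun h x => (stateEquiv hF).symm (h (stateEquiv hF x))
  have hΦ : Function.Injective Φ := fun h k hhk => by
    ext x
    have := congrFun hhk ((stateEquiv hF).symm x)
    simpa [Φ] using this
  have htrans : ∀ b x, trans F b x
      = (stateEquiv hF).symm (transAffine u b (stateEquiv hF x)) := fun b x => by
    rw [Equiv.eq_symm_apply, stateEquiv_trans, transAffine_apply, hu]
  have hedge : ∀ b h, ProductEdge F (Φ h) (Φ (transAffine u b * h)) := fun b h =>
    ⟨b, fun x => by simp [Φ, htrans]⟩
  have hset : {v : State F → State F | Relation.EqvGen (ProductEdge F) id v}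
      = Φ '' (transGroup u : Set (AdjoinRoot F ≃ᵃ[ZMod 2] AdjoinRoot F)) := by
    have hone : Φ 1 = id := by
      ext1 x
      simp [Φ]
    ext v
    constructor
    · intro hv
      have key : ∀ v w, Relation.EqvGen (ProductEdge F) v w →
          (v ∈ Φ '' (transGroup u : Set _) ↔ w ∈ Φ '' (transGroup u : Set _)) := by
        intro v w h
        induction h with
        | rel v w h =>
          obtain ⟨b, hb⟩ := h
          constructor
          · rintro ⟨h, hh, rfl⟩
            refine ⟨transAffine u b * h, mul_mem (transAffine_mem u b) hh, ?_⟩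
            ext1 x
            rw [hb, htrans]
            simp [Φ]
          · rintro ⟨h, hh, rfl⟩
            refine ⟨(transAffine u b)⁻¹ * h, mul_mem (inv_mem (transAffine_mem u b)) hh, ?_⟩
            ext1 x
            have := hb x
            rw [htrans] at this
            simp only [Φ, EmbeddingLike.apply_eq_iff_eq] at this
            simp [Φ, this, AffineEquiv.inv_def]
        | refl => rfl
        | symm _ _ _ ih => exact ih.symm
        | trans _ _ _ _ _ ih₁ ih₂ => exact ih₁.trans ih₂
      exact (key _ _ hv).1 ⟨1, one_mem _, hone⟩
    · rintro ⟨h, hh, rfl⟩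
      induction hh using Subgroup.closure_induction_left with
      | one => rw [hone]; exact .refl _
      | mul_left x hx y _ ih =>
        obtain ⟨b, rfl⟩ := hx
        exact ih.trans _ _ _ (.rel _ _ (hedge b y))
      | inv_mul_cancel x hx y _ ih =>
        obtain ⟨b, rfl⟩ := hx
        have := hedge b ((transAffine u b)⁻¹ * y)
        rw [mul_inv_cancel_left] at this
        exact ih.trans _ _ _ (.symm _ _ (.rel _ _ this))
  rw [polyPeriod, hset, Set.ncard_image_of_injective _ hΦ]
  rfl

/-- The element `z` of `ℤ₂[z]/(F)` is a unit if `F` has a nonzero constant term. -/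
theorem isUnit_root {F : (ZMod 2)[X]} (h0 : F.coeff 0 ≠ 0) : IsUnit (AdjoinRoot.root F) := by
  have h : AdjoinRoot.root F * AdjoinRoot.mk F F.divX + algebraMap _ _ (F.coeff 0) = 0 := by
    have := congrArg (AdjoinRoot.mk F) F.X_mul_divX_add
    rwa [AdjoinRoot.mk_self, map_add, map_mul, AdjoinRoot.mk_X] at this
  have hu : IsUnit (algebraMap (ZMod 2) (AdjoinRoot F) (F.coeff 0)) := (h0.isUnit).map _
  rw [eq_neg_of_add_eq_zero_right h, IsUnit.neg_iff] at hu
  exact isUnit_of_mul_isUnit_left hu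

theorem finite_adjoinRoot {F : (ZMod 2)[X]} (hF : F ≠ 0) : Finite (AdjoinRoot F) :=
  have := (AdjoinRoot.powerBasis hF).finite
  Module.finite_of_finite (ZMod 2)

theorem polyPeriod_pos {F : (ZMod 2)[X]} (h0 : F.coeff 0 ≠ 0) : 0 < polyPeriod F := by
  have hF : F ≠ 0 := by rintro rfl; simp at h0
  have := finite_adjoinRoot hF
  have : Finite (AdjoinRoot F ≃ᵃ[ZMod 2] AdjoinRoot F) :=
    Finite.of_injective _ DFunLike.coe_injective
  rw [polyPeriod_eq_card hF (isUnit_root h0).unit_spec]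
  exact Nat.card_pos

/-- If `e` is the order of `z` modulo `F`, then `F ^ (2 ^ n)` divides
`(z ^ e - 1) ^ (2 ^ n) = z ^ (e * 2 ^ n) - 1` in characteristic two, and `e * 2 ^ n` divides
`(2 * e) ^ n`. -/
theorem pow_dvd_X_pow_polyPeriod_sub_one {F : (ZMod 2)[X]} (h0 : F.coeff 0 ≠ 0) {n : ℕ}
    (hn : n ≠ 0) : F ^ (n + 1) ∣ X ^ (polyPeriod F ^ n) - 1 := by
  have hF : F ≠ 0 := by rintro rfl; simp at h0
  by_cases hunit : IsUnit F
  · exact (hunit.pow _).dvd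
  have := finite_adjoinRoot hF
  have : Nontrivial (AdjoinRoot F) := Ideal.Quotient.nontrivial_iff.2 (by
    rwa [Ne, Ideal.span_singleton_eq_top])
  set u := (isUnit_root h0).unit
  have hu : (u : AdjoinRoot F) = AdjoinRoot.root F := (isUnit_root h0).unit_spec
  have hX : F ∣ X ^ orderOf u - 1 := by
    rw [← AdjoinRoot.mk_eq_zero, map_sub, map_pow, AdjoinRoot.mk_X, ← hu,
      ← Units.val_pow_eq_pow_val, pow_orderOf_eq_one, Units.val_one, map_one, sub_self]
  have hdvd : orderOf u * 2 ^ n ∣ polyPeriod F ^ n := by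
    rw [polyPeriod_eq_card hF hu]
    refine dvd_trans ?_ (pow_dvd_pow_of_dvd (two_mul_orderOf_dvd_card u) n)
    rw [mul_pow, mul_comm]
    exact mul_dvd_mul_left _ (dvd_pow_self _ hn)
  calc F ^ (n + 1) ∣ F ^ (2 ^ n) := pow_dvd_pow _ n.lt_two_pow_self
    _ ∣ (X ^ orderOf u - 1) ^ (2 ^ n) := pow_dvd_pow_of_dvd hX _
    _ = X ^ (orderOf u * 2 ^ n) - 1 := by
      rw [sub_pow_char_pow (p := 2) (R := (ZMod 2)[X]), one_pow, pow_mul]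
    _ ∣ X ^ (polyPeriod F ^ n) - 1 := dvd_pow_sub_one_of_dvd hdvd

open LaurentPolynomial

theorem lord_spec {f : Laurent} (hf : f ≠ 0) :
    f.coeff (lord f) ≠ 0 ∧ ∀ k, f.coeff k ≠ 0 → lord f ≤ k := by
  obtain ⟨m, hm⟩ := Finset.min_of_nonempty
    (Finsupp.support_nonempty_iff.2 (AddMonoidAlgebra.coeff_eq_zero.not.2 hf))
  rw [lord, hm]
  exact ⟨Finsupp.mem_support_iff.1 (Finset.mem_of_min hm),
    fun k hk => Finset.min_le_of_eq (Finsupp.mem_support_iff.2 hk) hm⟩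

theorem toLaurent_trunc {f : Laurent} (hf : ∀ k, f.coeff k ≠ 0 → 0 ≤ k) :
    toLaurent (trunc f) = f := by
  have h : f = ∑ k ∈ f.coeff.support, LaurentPolynomial.C (f.coeff k) * T k := by
    conv_lhs => rw [← AddMonoidAlgebra.sum_coeff_single f]
    exact Finset.sum_congr rfl fun k _ => single_eq_C_mul_T _ _
  conv_lhs => rw [h]
  conv_rhs => rw [h]
  rw [map_sum, map_sum]
  refine Finset.sum_congr rfl fun k hk => ?_
  have := hf k (Finsupp.mem_support_iff.1 hk)
  rw [trunc_C_mul_T, if_pos this, ← C_mul_X_pow_eq_monomial, toLaurent_C_mul_X_pow,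
    Int.toNat_of_nonneg this]

theorem toLaurent_shiftToPoly {f : Laurent} (hf : f ≠ 0) :
    toLaurent (shiftToPoly f) = f * T (-lord f) :=
  toLaurent_trunc fun k hk => by
    rw [coeff_mul_T] at hk
    have := (lord_spec hf).2 _ hk
    omega

theorem coeff_zero_shiftToPoly_ne_zero {f : Laurent} (hf : f ≠ 0) :
    (shiftToPoly f).coeff 0 ≠ 0 := by
  have h : (toLaurent (shiftToPoly f)).coeff ((0 : ℕ) : ℤ) = (shiftToPoly f).coeff 0 := by
    rw [coeff_toLaurent]
    exact Finsupp.mapDomain_apply Nat.cast_injective _ 0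
  rw [← h, toLaurent_shiftToPoly hf, coeff_mul_T]
  simpa using (lord_spec hf).1

theorem periodConst_pos {f : Laurent} (hf : f ≠ 0) : 0 < periodConst f :=
  polyPeriod_pos (coeff_zero_shiftToPoly_ne_zero hf)

theorem pow_dvd_T_periodConst_sub_one {f : Laurent} (hf : f ≠ 0) {n : ℕ} (hn : n ≠ 0) :
    f ^ (n + 1) ∣ T ((periodConst f ^ n : ℕ) : ℤ) - 1 := by
  have h := map_dvd toLaurent
    (pow_dvd_X_pow_polyPeriod_sub_one (coeff_zero_shiftToPoly_ne_zero hf) hn)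
  rw [map_pow, toLaurent_shiftToPoly hf, map_sub, toLaurent_X_pow, map_one, mul_pow] at h
  exact (dvd_mul_right _ _).trans h

end

section

open LaurentPolynomial

/-! ### Blocks of piecewise periodic sequences -/

/-- The polynomial `∑ k, w_k z^k` whose coefficients are the letters of the word `w`. -/
def wordPoly (w : List (ZMod 2)) : Laurent := ∑ k : Fin w.length, C (w.get k) * T (k : ℤ)

theorem wordPoly_nil : wordPoly [] = 0 := by simp [wordPoly]

theorem wordPoly_cons (c : ZMod 2) (w : List (ZMod 2)) :
    wordPoly (c :: w) = C c + T 1 * wordPoly w := by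
  rw [wordPoly, wordPoly, Finset.mul_sum]
  refine (Fin.sum_univ_succ _).trans ?_
  congr 1
  · simp
  · refine Finset.sum_congr rfl fun k _ => ?_
    simp only [List.get_eq_getElem, Fin.val_succ, List.getElem_cons_succ]
    push_cast
    rw [T_add]
    ring

theorem wordPoly_append (v w : List (ZMod 2)) :
    wordPoly (v ++ w) = wordPoly v + T v.length * wordPoly w := by
  induction v with
  | nil => simp [wordPoly_nil]
  | cons c v ih =>
    rw [List.cons_append, wordPoly_cons, ih, wordPoly_cons, List.length_cons]
    push_cast
    rw [T_add]
    ring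

theorem wordPoly_replicate (c : ZMod 2) (m : ℕ) :
    (T 1 - 1) * wordPoly (List.replicate m c) = C c * (T m - 1) := by
  induction m with
  | zero => simp [wordPoly_nil]
  | succ m ih =>
    rw [List.replicate_succ, wordPoly_cons]
    push_cast
    rw [T_add]
    linear_combination T 1 * ih

theorem supportedIn_wordPoly (w : List (ZMod 2)) : SupportedIn 0 (w.length - 1) (wordPoly w) := by
  refine SupportedIn.sum fun k _ => ?_
  have := k.2
  exact ((supportedIn_C _).mul_T _).mono (by omega) (by omega)

theorem Represents.eq_wordPoly {f : Laurent} {D : ℤ} {w : List (ZMod 2)} (h : Represents f D w) :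
    f = T (D - w.length + 1) * wordPoly w := by
  rw [h, wordPoly, Finset.mul_sum]
  refine Finset.sum_congr rfl fun k _ => ?_
  rw [T_add]
  ring

theorem periodicWord_singleton (c : ZMod 2) (m : ℕ) :
    periodicWord [c] m = List.replicate m c := by
  simp [periodicWord]

/-- The definition of `pieceWord`, with the natural numbers as indices: there, the list of indices
is coerced to a list of integers. -/
theorem pieceWord_eq (s t : ℤ) (n q : ℤ → List (ZMod 2)) (m : ℕ) :
    pieceWord s t n q m = ((List.range (t - s).toNat).flatMap fun i : ℕ =>
      n (s + (i : ℤ)) ++ periodicWord (q (s + (i : ℤ))) m) ++ n t := by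
  rw [pieceWord, List.bind_eq_flatMap, List.flatMap_assoc]
  simp

/-- Multiplication by `z - 1` annihilates the constant interiors of the periodic parts, and only
blocks near the multiples of `δ` remain. -/
theorem sub_one_mul_wordPoly_pieces (A : ℕ) (s : ℤ) (n q : ℤ → List (ZMod 2)) (l : ℕ)
    (hn : ∀ i : ℕ, i < l → (n (s + i)).length = 2 * A + 1)
    (hq : ∀ i : ℕ, i < l → ∃ c, q (s + i) = [c]) :
    ∃ φ : ParamPoly, (∀ i, SupportedIn (-A) (A + 1) (φ i)) ∧ ∀ δ : ℕ, 2 * A + 1 ≤ δ →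
      let w := (List.range l).flatMap fun i : ℕ =>
        n (s + (i : ℤ)) ++ periodicWord (q (s + (i : ℤ))) (δ - 2 * A - 1)
      w.length = l * δ ∧
      (T 1 - 1) * (T (s * δ - A) * wordPoly w) = φ.inst δ := by
  induction l with
  | zero => exact ⟨0, fun i => supportedIn_zero _ _, fun δ _ => by
      simp [wordPoly_nil, ParamPoly.inst_zero]⟩
  | succ l ih =>
    obtain ⟨φ, hφ, h⟩ := ih (fun i hi => hn i (by omega)) (fun i hi => hq i (by omega))
    obtain ⟨c, hc⟩ := hq l (by omega)
    have hnl := hn l (by omega)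
    have hN : SupportedIn (-A) (A + 1)
        (T (-A) * (T 1 - 1) * wordPoly (n (s + l)) - C c * T (A + 1)) := by
      rw [sub_eq_add_neg, sub_eq_add_neg]
      refine SupportedIn.add ?_ (SupportedIn.neg ?_)
      · refine (((supportedIn_T _).mul (SupportedIn.add (a := 0) (b := 1) ?_ ?_)).mul
          (supportedIn_wordPoly _)).mono (by omega) (by rw [hnl]; push_cast; omega)
        · exact (supportedIn_T 1).mono (by omega) (by omega)
        · rw [← T_zero]
          exact (supportedIn_T 0).neg.mono (by omega) (by omega)
      · exact ((supportedIn_C c).mul_T _).mono (by omega) (by omega)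
    refine ⟨φ + Finsupp.single (s + l)
        (T (-A) * (T 1 - 1) * wordPoly (n (s + l)) - C c * T (A + 1))
        + Finsupp.single (s + l + 1) (C c * T (-A)), fun i => ?_, fun δ hδ => ?_⟩
    · rw [Finsupp.add_apply, Finsupp.add_apply]
      refine ((hφ i).add ?_).add ?_
      · rw [Finsupp.single_apply]
        split_ifs
        · exact hN
        · exact supportedIn_zero _ _
      · rw [Finsupp.single_apply]
        split_ifs
        · exact ((supportedIn_C c).mul_T _).mono (by omega) (by omega)
        · exact supportedIn_zero _ _
    · obtain ⟨hlen, hw⟩ := h δ hδ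
      simp only [List.range_succ, List.flatMap_append, List.flatMap_singleton, hc,
        periodicWord_singleton, List.length_append, List.length_replicate, hnl]
      refine ⟨by rw [hlen, add_mul]; omega, ?_⟩
      rw [wordPoly_append, wordPoly_append, hlen, hnl, ParamPoly.inst_add, ParamPoly.inst_add,
        ParamPoly.inst_single, ParamPoly.inst_single, ← hw]
      have hr := wordPoly_replicate c (δ - 2 * A - 1)
      have e1 : (T (s * δ - A) * T ((l * δ : ℕ) : ℤ) : Laurent) = T (-A) * T ((s + l) * δ) := by
        rw [← T_add, ← T_add]
        congr 1
        push_cast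
        ring
      have e2 : (T (-A) * T ((2 * A + 1 : ℕ) : ℤ) : Laurent) = T (A + 1) := by
        rw [← T_add]
        congr 1
        push_cast
        ring
      have e3 : (T (A + 1) * T ((s + l) * δ) * T ((δ - 2 * A - 1 : ℕ) : ℤ) : Laurent)
          = T (-A) * T ((s + l + 1) * δ) := by
        rw [← T_add, ← T_add, ← T_add]
        congr 1
        have : ((δ - 2 * A - 1 : ℕ) : ℤ) = δ - 2 * A - 1 := by omega
        rw [this]
        ring
      set S := wordPoly (n (s + l))
      set V := wordPoly (List.replicate (δ - 2 * A - 1) c)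
      linear_combination (T 1 - 1) * (S + T ((2 * A + 1 : ℕ) : ℤ) * V) * e1
        + (T 1 - 1) * V * T ((s + l) * δ) * e2 + T (A + 1) * T ((s + l) * δ) * hr + C c * e3

/-- The blocks of a parametric polynomial with `(A, 1)`-periodic instances are supported in
`[-A, A]`. -/
theorem IsPeriodicSeq.supportedIn {A : ℕ} {f : ParamPoly}
    (h : IsPeriodicSeq A 1 (fun δ : ℕ => f.inst (δ : ℤ))) (i : ℤ) :
    SupportedIn (-A) A (f i) := by
  obtain ⟨-, s, t, hst, n, q, hn, hq, N, hN, hrep⟩ := h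
  obtain ⟨φ, hφ, hw⟩ := sub_one_mul_wordPoly_pieces A s n q (t - s).toNat
    (fun i hi => hn _ (by omega) (by omega))
    (fun i hi => List.length_eq_one_iff.1 (hq _ (by omega) (by omega)))
  have hnt := hn t hst le_rfl
  have hT1 : SupportedIn 0 1 (T 1 - 1 : Laurent) := by
    rw [sub_eq_add_neg, ← T_zero]
    exact ((supportedIn_T 1).mono (by omega) (by omega)).add
      ((supportedIn_T 0).neg.mono (by omega) (by omega))
  have hT : SupportedIn (-A) (A + 1) ((T 1 - 1) * (T (-A) * wordPoly (n t))) :=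
    (hT1.mul ((supportedIn_T _).mul (supportedIn_wordPoly _))).mono (by omega)
      (by rw [hnt]; push_cast; omega)
  have heq : (T 1 - 1 : Laurent) • f
      = φ + Finsupp.single t ((T 1 - 1) * (T (-A) * wordPoly (n t))) := by
    refine ParamPoly.eq_of_eventually_inst_eq (N := N) fun δ hδ => ?_
    obtain ⟨hlen, hw⟩ := hw δ (by omega)
    have hr : f.inst δ = _ := (hrep δ hδ).eq_wordPoly
    rw [pieceWord_eq, List.length_append, hlen, hnt, wordPoly_append, hlen] at hr
    rw [ParamPoly.inst_smul, ParamPoly.inst_add, ParamPoly.inst_single, ← hw, hr]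
    have hts : ((t - s).toNat : ℤ) = t - s := by omega
    have e1 : (δ * t + A - (((t - s).toNat * δ + (2 * A + 1) : ℕ) : ℤ) + 1 : ℤ) = s * δ - A := by
      push_cast
      rw [hts]
      ring
    have e2 : (T (s * δ - A) * T (((t - s).toNat * δ : ℕ) : ℤ) : Laurent) = T (-A) * T (t * δ) := by
      rw [← T_add, ← T_add]
      congr 1
      push_cast
      rw [hts]
      ring
    rw [e1]
    linear_combination (T 1 - 1) * wordPoly (n t) * e2
  have hi : SupportedIn (-A) (A + 1) ((T 1 - 1) * f i) := by
    have := DFunLike.congr_fun heq i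
    rw [Finsupp.smul_apply, smul_eq_mul, Finsupp.add_apply] at this
    rw [this]
    refine (hφ i).add ?_
    rw [Finsupp.single_apply]
    split_ifs
    · exact hT
    · exact supportedIn_zero _ _
  -- The factor `z - 1` has nonzero coefficients at `0` and at `1`.
  have hcoeff (k : ℤ) : (T 1 - 1 : Laurent).coeff k
      = (if 1 = k then 1 else 0) - (if 0 = k then 1 else 0) := by
    rw [← T_zero]
    simp [-T_zero]
  intro k hk
  have h0 := hi.add_mem_of_mul (u := 0) (by rw [hcoeff]; simp) hk
  have h1 := hi.add_mem_of_mul (u := 1) (by rw [hcoeff]; simp) hk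
  omega

end

/-! ### The bounds -/

theorem ParamPoly.inst_dvd_bound_of_spanDiff_neg {f g : ParamPoly} (hf : f ≠ 0) (hg : g ≠ 0)
    {A B : ℕ} (hA : ∀ i, SupportedIn (-A) A (f i)) (hB : ∀ i, SupportedIn (-B) B (g i))
    (hneg : spanDiff f g < 0) {δ : ℤ} (hδ : 0 ≤ δ) (hdvd : f.inst δ ∣ g.inst δ) :
    δ ≤ 2 * B + 2 * A :=
  ParamPoly.le_of_inst_dvd_inst hf hg hA hB (by omega) hδ
    (fun _ hi => ⟨ParamPoly.ordδ_le hi, ParamPoly.le_degδ hi⟩) (by rw [spanDiff] at hneg; omega)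
    hdvd

/-- A solution above the bound is congruent, modulo the `n`-th power of the period constant, to
some `δ` in the first period after `2 * A`, where `f_δ ≠ 0`. -/
theorem exists_small_divides {f g : ParamPoly} (hf : f ≠ 0) {A B : ℕ}
    (hA : ∀ i, SupportedIn (-A) A (f i)) (hB : ∀ i, SupportedIn (-B) B (g i)) (n : ℕ)
    (hn : spanDiff f g = n) {δ : ℕ} (hlarge : 2 * (B + (n + 1) * A) + 2 * A < δ)
    (hdvd : f.inst δ ∣ g.inst δ) :
    ∃ ε : ℕ, ε ≤ 2 * A + periodConst (f f.degδ) ^ n ∧ Divides (f.inst ε) (g.inst ε) := by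
  have hc := ParamPoly.apply_degδ_ne_zero hf
  set M := periodConst (f f.degδ) ^ n with hM
  have hMpos : 0 < M := pow_pos (periodConst_pos hc) n
  have hA' : 2 * A + 1 ≤ δ := by
    have : 0 ≤ 2 * (B + (n + 1) * A) := Nat.zero_le _
    omega
  have hmod := Nat.mod_lt (δ - (2 * A + 1)) hMpos
  have hdiv : ((2 * A + 1 + (δ - (2 * A + 1)) % M : ℕ) : ℤ)
      + ((δ - (2 * A + 1)) / M : ℕ) * (M : ℤ) = δ := by
    have := Nat.mod_add_div' (δ - (2 * A + 1)) M
    rw [← Nat.cast_mul, ← Nat.cast_add]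
    congr 1
    omega
  refine ⟨2 * A + 1 + (δ - (2 * A + 1)) % M, by omega,
    ParamPoly.inst_ne_zero hf hA (by push_cast; omega), ?_⟩
  refine inst_dvd_inst_of_periodic hf (by omega) (by omega) hA hB n hn (M := M)
    (fun h0 => pow_dvd_T_periodConst_sub_one hc h0) (m := (δ - (2 * A + 1)) / M) ?_ ?_
  · rw [hdiv]
    exact_mod_cast hlarge
  · rw [hdiv]
    exact hdvd

theorem divPos_of_nat {f g : ParamPoly} {N : ℕ}
    (h : ∃ δ : ℕ, δ ≤ N ∧ Divides (f.inst (δ : ℤ)) (g.inst (δ : ℤ))) : DivPos f g := by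
  obtain ⟨δ, -, h⟩ := h
  exact ⟨δ, by omega, h⟩

end DivBound
end

theorem mainTheorem3 (f g : DivBound.ParamPoly) (hf : f ≠ 0) (hg : g ≠ 0) (A B : ℕ)
    (hfA : DivBound.IsPeriodicSeq A 1 (fun δ : ℕ => f.inst (δ : ℤ)))
    (hgB : DivBound.IsPeriodicSeq B 1 (fun δ : ℕ => g.inst (δ : ℤ)))
    (hAB : A ≤ B) :
    (DivBound.spanDiff f g < 0 →
      (DivBound.DivPos f g ↔
        ∃ δ : ℕ, δ ≤ 2 * B + 2 * A ∧
          DivBound.Divides (f.inst (δ : ℤ)) (g.inst (δ : ℤ)))) ∧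
    (∀ Δ : ℕ, DivBound.spanDiff f g = (Δ : ℤ) →
      (DivBound.DivPos f g ↔
        ∃ δ : ℕ, δ ≤ DivBound.periodConst (f f.degδ) ^ Δ + 2 * (B + 4 * A * Δ) + 4 * A + 1 ∧
          DivBound.Divides (f.inst (δ : ℤ)) (g.inst (δ : ℤ)))) := by
  refine ⟨fun hneg => ⟨?_, DivBound.divPos_of_nat⟩, fun Δ hΔ => ⟨?_, DivBound.divPos_of_nat⟩⟩
  · rintro ⟨δ, hδ, hne, hdvd⟩
    lift δ to ℕ using hδ
    have := DivBound.ParamPoly.inst_dvd_bound_of_spanDiff_neg hf hg hfA.supportedIn hgB.supportedIn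
      hneg (by omega) hdvd
    exact ⟨δ, by omega, hne, hdvd⟩
  · rintro ⟨δ, hδ, hne, hdvd⟩
    lift δ to ℕ using hδ
    by_cases hsmall : δ ≤ 2 * (B + (Δ + 1) * A) + 2 * A
    · have := Nat.zero_le (A * Δ)
      exact ⟨δ, by nlinarith [Nat.zero_le (DivBound.periodConst (f f.degδ) ^ Δ)], hne, hdvd⟩
    · obtain ⟨ε, hε, h⟩ := DivBound.exists_small_divides hf hfA.supportedIn hgB.supportedIn Δ hΔ
        (by omega) hdvd
      exact ⟨ε, by omega, h⟩
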